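/- Let $K$ be a finite simplicial complex and let $X\to K=X/\Gamma$ be a $\Gamma$-covering, that is, $\Gamma$ is a discrete group acting freely on the simplicial complex $X$ by simplicial automorphisms and $X\to K$ is a simplicial covering map whose fibres are the $\Gamma$-orbits. For $k\ge 0$ and $p\in[1,\infty]$ let $\ell^pX^k$ be the space of complex $\ell^p$ simplicial $k$-cochains of $X$ (simplices oriented $\Gamma$-invariantly), and let $d_k$ be the simplicial coboundary; it defines a bounded operator $d_k:\ell^2X^k\to\ell^2X^{k+1}$. Put $A=d_k^*d_k$ and, for $\lambda>0$, let $E_\lambda\subset(\ker d_k)^\perp\subset\ell^2X^k$ be the range of the spectral projection $\Pi_\lambda=\chi_A(]0,\lambda])$. Let $$F_{\Gamma,k}(\lambda)=\dim_\Gamma E_\lambda=\tau_\Gamma(\Pi_\lambda)=\sum_{\sigma}\langle \Pi_\lambda\delta_\sigma,\delta_\sigma\rangle ,$$ where $\sigma$ runs over a set of representatives of the $\Gamma$-orbits of $k$-simplices of $X$, be the spectral density function of $A$ on $(\ker d_k)^\perp$. Suppose that for some real $\alpha>2$ and some constant $C$ one has $F_{\Gamma,k}(\lambda)\le C\lambda^{\alpha/2}$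 for all $\lambda>0$. Then for every $p\in[1,\infty]$ with $\frac1p\le\frac12-\frac1\alpha$ (where $1/\infty=0$): 1. there is a constant $C'$ such that every $\beta\in(\ker d_k)^\perp\subset\ell^2X^k$ belongs to $\ell^pX^k$ and satisfies $\|\beta\|_p\le C'\|d_k\beta\|_2$; 2. $\overline{d_k(\ell^2X^k)}^{\,\ell^2}\subset d_k(\ell^pX^k)$, i.e. every element of the closure of $d_k(\ell^2X^k)$ in $\ell^2X^{k+1}$ is equal to $d_kb$ for some $b\in\ell^pX^k$. -/

import Mathlib

open scoped ENNReal InnerProductSpace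

noncomputable section

namespace SimplicialL2

/-- The `k`-simplices (faces with `k + 1` vertices) of a simplicial complex. -/
def Simplices {V : Type*} (X : AbstractSimplicialComplex V) (k : ℕ) : Type _ :=
  {s : Finset V // s ∈ X ∧ s.card = k + 1}

/-- The space `ℓ^p X^k` of complex-valued `ℓ^p` cochains of degree `k`. -/
abbrev LpCochains {V : Type*} (X : AbstractSimplicialComplex V) (k : ℕ) (p : ℝ≥0∞) : Type _ :=
  lp (fun _ : Simplices X k => ℂ) p

/-- `π : V → W` is (the vertex map of) a simplicial covering map `X → K`: a surjective simplicial
map, injective on simplices, such that every simplex of `K` lifts uniquely once the lift of one of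
its vertices is prescribed. Equivalently the induced map of geometric realizations is a covering
(onto `K`), and `X` carries the lifted triangulation. -/
structure IsCovering {V W : Type*} [DecidableEq W] (X : AbstractSimplicialComplex V)
    (K : AbstractSimplicialComplex W) (π : V → W) : Prop where
  surjective : Function.Surjective π
  map_mem : ∀ s ∈ X, s.image π ∈ K
  injOn : ∀ s ∈ X, Set.InjOn π (s : Set V)
  lift : ∀ (v : V), ∀ t ∈ K, π v ∈ t → ∃! s : Finset V, s ∈ X ∧ v ∈ s ∧ s.image π = t

/-- `π` is a `Γ`-covering `X → K = X / Γ`: a simplicial covering such that `Γ` acts freely on `X`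
by simplicial automorphisms and the fibres of `π` are exactly the `Γ`-orbits. -/
structure IsGaloisCovering (Γ : Type*) {V W : Type*} [Group Γ] [MulAction Γ V] [DecidableEq W]
    (X : AbstractSimplicialComplex V) (K : AbstractSimplicialComplex W) (π : V → W) : Prop
    extends IsCovering X K π where
  smul_mem : ∀ (γ : Γ), ∀ s ∈ X, s.map (MulAction.toPerm γ).toEmbedding ∈ X
  free : ∀ (γ : Γ) (v : V), γ • v = v → γ = 1
  fibre : ∀ v v' : V, π v = π v' ↔ ∃ γ : Γ, γ • v = v'

section Coboundary

variable {V W : Type*} [DecidableEq V] [LinearOrder W]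
  {X : AbstractSimplicialComplex V} {K : AbstractSimplicialComplex W} {k : ℕ}

/-- The face of the `(k+1)`-simplex `τ` opposite to its vertex `v`. -/
def oppositeFace (τ : Simplices X (k + 1)) (v : V) (hv : v ∈ τ.1) : Simplices X k :=
  ⟨τ.1.erase v, by
    have hc : (τ.1.erase v).card = k + 1 := by
      rw [Finset.card_erase_of_mem hv, τ.2.2]; rfl
    refine ⟨?_, hc⟩
    exact (X.isRelLowerSet_faces τ.2.1).2 (Finset.erase_subset _ _)
      (Finset.card_pos.1 (by omega))⟩

/-- The simplicial coboundary on arbitrary `k`-cochains,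
`(d f)(τ) = ∑ i, (-1)^i f(v₀, …, v̂ᵢ, …, v_{k+1})`,
the vertices `v₀, …, v_{k+1}` of `τ` being listed in the order pulled back by `π` from a total order
on the vertices of the base. (For a covering `π` this is an orientation of the simplices of `X` that
is invariant under deck transformations.) The exponent counts the vertices that precede `v`. -/
def coboundary (π : V → W) (f : Simplices X k → ℂ) (τ : Simplices X (k + 1)) : ℂ :=
  ∑ v : {v // v ∈ τ.1},
    (-1 : ℂ) ^ (τ.1.filter (fun u => π u < π v)).card * f (oppositeFace τ v v.2)

theorem coboundary_add (π : V → W) (f g : Simplices X k → ℂ) :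
    coboundary π (f + g) = coboundary π f + coboundary π g := by
  funext τ
  simp [coboundary, mul_add, Finset.sum_add_distrib]

theorem coboundary_smul (π : V → W) (c : ℂ) (f : Simplices X k → ℂ) :
    coboundary π (c • f) = c • coboundary π f := by
  funext τ
  simp only [coboundary, Pi.smul_apply, smul_eq_mul, Finset.mul_sum]
  exact Finset.sum_congr rfl fun v _ => by ring

theorem norm_coboundary_sq_le (π : V → W) (f : Simplices X k → ℂ) (τ : Simplices X (k + 1)) :
    ‖coboundary π f τ‖ ^ 2 ≤ (k + 2) * ∑ v : {v // v ∈ τ.1}, ‖f (oppositeFace τ v v.2)‖ ^ 2 := by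
  have h1 : ‖coboundary π f τ‖ ≤ ∑ v : {v // v ∈ τ.1}, ‖f (oppositeFace τ v v.2)‖ := by
    refine (norm_sum_le _ _).trans (Finset.sum_le_sum fun v _ => ?_)
    simp
  have h2 := sq_sum_le_card_mul_sum_sq (s := (Finset.univ : Finset {v // v ∈ τ.1}))
    (f := fun v => ‖f (oppositeFace τ v v.2)‖)
  have h3 : ((Finset.univ : Finset {v // v ∈ τ.1}).card : ℝ) = k + 2 := by
    rw [Finset.card_univ, Fintype.card_coe, τ.2.2]; push_cast; ring
  rw [h3] at h2
  exact (pow_le_pow_left₀ (norm_nonneg _) h1 2).trans h2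

/-- In a covering of a finite complex, each simplex is a face of boundedly many simplices. -/
theorem card_cofaces_le [Fintype W] {π : V → W} (hπ : IsCovering X K π) (σ : Simplices X k)
    (P : Finset (Σ τ : Simplices X (k + 1), {v // v ∈ τ.1}))
    (hP : ∀ x ∈ P, oppositeFace x.1 x.2.1 x.2.2 = σ) :
    P.card ≤ Fintype.card (Finset W × W) := by
  classical
  obtain ⟨u, hu⟩ : σ.1.Nonempty := Finset.card_pos.1 (by rw [σ.2.2]; omega)
  have hmem : ∀ x ∈ P, u ∈ x.1.1 := fun x hx => by
    rw [← hP x hx] at hu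
    exact Finset.mem_of_mem_erase hu
  refine Finset.card_le_card_of_injOn (t := Finset.univ)
    (fun x => (x.1.1.image π, π x.2.1)) (fun _ _ => Finset.mem_coe.2 (Finset.mem_univ _)) ?_
  rintro ⟨τ, v, hv⟩ hx ⟨τ', v', hv'⟩ hx' h
  simp only [Prod.mk.injEq] at h
  have e : τ.1 = τ'.1 :=
    (hπ.lift u (τ.1.image π) (hπ.map_mem _ τ.2.1)
      (Finset.mem_image_of_mem _ (hmem _ hx))).unique
      ⟨τ.2.1, hmem _ hx, rfl⟩ ⟨τ'.2.1, hmem _ hx', h.1.symm⟩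
  obtain rfl : τ = τ' := Subtype.ext e
  obtain rfl : v = v' := hπ.injOn _ τ.2.1 hv hv' h.2
  rfl

theorem sum_norm_coboundary_sq_le [Fintype W] {π : V → W} (hπ : IsCovering X K π)
    (f : LpCochains X k 2) (T : Finset (Simplices X (k + 1))) :
    ∑ τ ∈ T, ‖coboundary π f τ‖ ^ 2 ≤
      (k + 2) * (Fintype.card (Finset W × W) * ‖f‖ ^ 2) := by
  classical
  let P : Finset (Σ τ : Simplices X (k + 1), {v // v ∈ τ.1}) := T.sigma fun _ => Finset.univ
  let g : (Σ τ : Simplices X (k + 1), {v // v ∈ τ.1}) → Simplices X k :=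
    fun x => oppositeFace x.1 x.2.1 x.2.2
  have h1 : ∑ τ ∈ T, ‖coboundary π f τ‖ ^ 2 ≤ (k + 2) * ∑ x ∈ P, ‖f (g x)‖ ^ 2 := by
    rw [Finset.sum_sigma, Finset.mul_sum]
    exact Finset.sum_le_sum fun τ _ => norm_coboundary_sq_le π f τ
  have h2 : ∑ x ∈ P, ‖f (g x)‖ ^ 2 ≤
      Fintype.card (Finset W × W) * ∑ σ ∈ P.image g, ‖f σ‖ ^ 2 := by
    rw [Finset.sum_comp (fun σ => ‖f σ‖ ^ 2) g, Finset.mul_sum]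
    refine Finset.sum_le_sum fun σ _ => ?_
    rw [nsmul_eq_mul]
    refine mul_le_mul_of_nonneg_right ?_ (by positivity)
    exact_mod_cast card_cofaces_le hπ σ _ fun x hx => (Finset.mem_filter.1 hx).2
  have h3 : ∑ σ ∈ P.image g, ‖f σ‖ ^ 2 ≤ ‖f‖ ^ 2 := by
    have := lp.sum_rpow_le_norm_rpow (p := 2) (by norm_num) f (P.image g)
    simpa using this
  refine h1.trans (mul_le_mul_of_nonneg_left (h2.trans ?_) (by positivity))
  exact mul_le_mul_of_nonneg_left h3 (by positivity)

/-- The coboundary as a bounded operator `d_k : ℓ²X^k → ℓ²X^{k+1}`, for a covering `X` of a finite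
complex. -/
def coboundaryL2 [Finite W] {π : V → W} (hπ : IsCovering X K π) (k : ℕ) :
    LpCochains X k 2 →L[ℂ] LpCochains X (k + 1) 2 :=
  LinearMap.mkContinuousOfExistsBound
    { toFun := fun f => ⟨coboundary π f, by
        have := Fintype.ofFinite W
        refine memℓp_gen' (C := (k + 2) * (Fintype.card (Finset W × W) * ‖f‖ ^ 2)) fun T => ?_
        simpa using sum_norm_coboundary_sq_le hπ f T⟩
      map_add' := fun f g => lp.ext (coboundary_add π f g)
      map_smul' := fun c f => lp.ext (coboundary_smul π c f) }
    (by
      have := Fintype.ofFinite W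
      refine ⟨Real.sqrt ((k + 2) * Fintype.card (Finset W × W)), fun f => ?_⟩
      refine lp.norm_le_of_forall_sum_le (p := 2) (by norm_num) (by positivity) fun T => ?_
      have h := sum_norm_coboundary_sq_le hπ f T
      have e : (Real.sqrt ((k + 2) * Fintype.card (Finset W × W)) * ‖f‖) ^ 2 =
          (k + 2) * (Fintype.card (Finset W × W) * ‖f‖ ^ 2) := by
        rw [mul_pow, Real.sq_sqrt (by positivity)]; ring
      rw [← e] at h
      simpa using h)

theorem coboundaryL2_apply [Finite W] {π : V → W} (hπ : IsCovering X K π) (k : ℕ)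
    (f : LpCochains X k 2) : ⇑(coboundaryL2 hπ k f) = coboundary π f := rfl

end Coboundary

section Spectral

variable {H : Type*} [NormedAddCommGroup H] [InnerProductSpace ℂ H] [CompleteSpace H]

/-- The spectral subspace `E_λ = range χ_A(]0, λ])` of a bounded positive self-adjoint operator `A`.
The range of `χ_A(]-∞, λ])` is the kernel of the positive part `(A - λ)₊ = g(A)`,
`g(x) = max (x - λ) 0`, as `g` is continuous and its zero set is `]-∞, λ]`; the range of
`χ_A(]0, ∞[)` is `(ker A)ᗮ`. -/
def spectralSubspace (A : H →L[ℂ] H) (lam : ℝ) : Submodule ℂ H :=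
  LinearMap.ker (cfc (fun x : ℝ => max (x - lam) 0) A).toLinearMap ⊓ (LinearMap.ker A.toLinearMap)ᗮ

instance (A : H →L[ℂ] H) (lam : ℝ) : CompleteSpace (spectralSubspace A lam) :=
  IsClosed.completeSpace_coe (hs := by
    rw [spectralSubspace, Submodule.coe_inf]
    exact (ContinuousLinearMap.isClosed_ker _).inter (Submodule.isClosed_orthogonal _))

end Spectral

section Dimension

variable (Γ : Type*) {V : Type*} [Group Γ] [MulAction Γ V] (X : AbstractSimplicialComplex V) (k : ℕ)

/-- Two `k`-simplices of `X` are equivalent if they are in the same `Γ`-orbit. -/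
def simplexOrbit : Setoid (Simplices X k) where
  r σ τ := ∃ γ : Γ, σ.1.map (MulAction.toPerm γ).toEmbedding = τ.1
  iseqv :=
    { refl := fun σ => ⟨1, by ext; simp⟩
      symm := by
        rintro σ τ ⟨γ, h⟩
        refine ⟨γ⁻¹, ?_⟩
        rw [← h]; ext; simp
      trans := by
        rintro σ τ ρ ⟨γ, h⟩ ⟨γ', h'⟩
        refine ⟨γ' * γ, ?_⟩
        rw [← h', ← h]; ext; simp [mul_smul] }

variable {X k}

/-- The von Neumann dimension `dim_Γ E = τ_Γ(Π_E)` of a closed `Γ`-invariant subspace `E` of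
`ℓ²X^k ≃ ℓ²(Γ) ⊗ ℂⁿ`: the sum of the diagonal coefficients `⟪Π_E δ_σ, δ_σ⟫` of the orthogonal
projection `Π_E`, where `σ` runs over representatives of the `Γ`-orbits of `k`-simplices. -/
def vonNeumannDim (E : Submodule ℂ (LpCochains X k 2)) [E.HasOrthogonalProjection] : ℝ≥0∞ :=
  open Classical in
  ∑' o : Quotient (simplexOrbit Γ X k),
    ENNReal.ofReal
      (⟪(lp.single 2 o.out (1 : ℂ) : LpCochains X k 2),
        E.starProjection (lp.single 2 o.out (1 : ℂ))⟫_ℂ).re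

end Dimension

/-- The spectral density `F_{Γ,k}(λ) = dim_Γ E_λ` of `A = d_k^* d_k` on `(ker d_k)ᗮ`. -/
def spectralDensity (Γ : Type*) {V W : Type*} [Group Γ] [MulAction Γ V] [DecidableEq V]
    [LinearOrder W] [Finite W] {X : AbstractSimplicialComplex V} {K : AbstractSimplicialComplex W}
    {π : V → W} (hπ : IsGaloisCovering Γ X K π) (k : ℕ) (lam : ℝ) : ℝ≥0∞ :=
  vonNeumannDim Γ
    (spectralSubspace
      ((coboundaryL2 hπ.toIsCovering k).adjoint ∘L coboundaryL2 hπ.toIsCovering k) lam)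

end SimplicialL2

end

/-! This is a Sobolev inequality deduced from ultracontractivity. Evaluation at `σ` is pairing with
`δ_σ`, so for `w ∈ E_λ` Cauchy–Schwarz gives `|w(σ)| ≤ ‖Π_λ δ_σ‖ ‖w‖`. By `Γ`-invariance `‖Π_λ
δ_σ‖²` is one of the terms of `F(λ)`, whence `|w(σ)| ≤ √C λ^(α/4) ‖w‖`
(`norm_apply_le_of_spectralDensity_le`).

For `x ⊥ ker A` with energy `D² = ⟪x, A x⟫`, split `x` at each scale `2^j` by continuous cutoffs. A
dyadic increment of the low part has norm `O(D λ^(-1/2))`, so pointwise it is `O(D λ^((α-2)/4))`. As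
`α > 2` these bounds sum geometrically from `-∞` (`norm_lowPass_apply_le`). At each simplex choose
the scale where the low part is at most `|x(σ)|/2`; the high part then controls `x(σ)`. With `q =
2α/(α-2)`, summing `|x(σ)|^q` leaves `∑ 2^j ‖high_j x‖²`, which is `O(D²)` by a scalar inequality on
the spectrum (`exists_sum_norm_highPass_sq_le`). This gives the `ℓ^q` bound (`exists_sum_rpow_le`),
and `ℓ^q ⊆ ℓ^p` for `p ≥ q`. Primitives of limits come from completeness of `ℓ^p`. -/

namespace SimplicialL2

/-! ### Geometric and dyadic estimates on the real line. -/

section Reals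

open Filter Topology

theorem tendsto_zpow_atBot_zero {r : ℝ} (hr : 1 < r) :
    Tendsto (fun j : ℤ => r ^ j) atBot (𝓝 0) := by
  have h1 : Tendsto (fun j : ℤ => (j : ℝ) * Real.log r) atBot atBot :=
    (tendsto_intCast_atBot_iff.2 tendsto_id).atBot_mul_const (Real.log_pos hr)
  refine (Real.tendsto_exp_atBot.comp h1).congr fun j => ?_
  simp only [Function.comp]
  rw [mul_comm, ← Real.rpow_def_of_pos (by linarith), Real.rpow_intCast]

/-- A sequence vanishing at `-∞` with geometrically bounded increments is geometrically bounded. -/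
theorem le_geometric_of_increment_le {a : ℤ → ℝ} {r B : ℝ} (hr : 1 < r)
    (ha : ∀ j, a j ≤ a (j - 1) + B * r ^ j) (h0 : Tendsto a atBot (𝓝 0)) (j : ℤ) :
    a j ≤ B * (r / (r - 1)) * r ^ j := by
  have hr0 : r ≠ 0 := by linarith
  have hr1 : r - 1 ≠ 0 := by linarith
  -- `B * (r / (r - 1)) * r ^ j` is the sum of `B * r ^ i` over `i ≤ j`. The difference decreases in
  -- `j` and tends to `0` at `-∞`, so it is never positive.
  have hanti : Antitone fun j : ℤ => a j - B * (r / (r - 1)) * r ^ j := by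
    refine antitone_int_of_succ_le fun j => ?_
    have h := ha (j + 1)
    rw [add_sub_cancel_right] at h
    have e : B * (r / (r - 1)) * r ^ (j + 1) = B * (r / (r - 1)) * r ^ j + B * r ^ (j + 1) := by
      rw [zpow_add_one₀ hr0]
      field_simp
      ring
    linarith
  have hlim : Tendsto (fun j : ℤ => a j - B * (r / (r - 1)) * r ^ j) atBot (𝓝 0) := by
    simpa using h0.sub ((tendsto_zpow_atBot_zero hr).const_mul (B * (r / (r - 1))))
  have := ge_of_tendsto hlim ((eventually_le_atBot j).mono fun i hi => hanti hi)
  simpa using this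

theorem summable_half_pow_natAbs : Summable fun j : ℤ => ((1 / 2 : ℝ)) ^ j.natAbs := by
  refine summable_int_iff_summable_nat_and_neg.2 ⟨?_, ?_⟩ <;>
    simpa using summable_geometric_two

/-- The term is `2^j` below the scale of `x` and `x²/2^j` above it, so it decays geometrically on
both sides of `n`. -/
theorem dyadic_mul_min_sq_le {x : ℝ} (hx : 0 < x) {n : ℤ} (hn1 : (2 : ℝ) ^ n ≤ x)
    (hn2 : x < 2 ^ (n + 1)) (j : ℤ) :
    (2 : ℝ) ^ j * min (x / 2 ^ j) 1 ^ 2 ≤ 2 * x * (1 / 2) ^ (j - n).natAbs := by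
  have hj : (0 : ℝ) < 2 ^ j := by positivity
  have hm0 : 0 ≤ min (x / 2 ^ j) 1 := le_min (by positivity) zero_le_one
  rcases le_total j n with h | h
  · obtain ⟨m, rfl⟩ : ∃ m : ℕ, n = j + m := ⟨(n - j).toNat, by omega⟩
    have e : (j - (j + m)).natAbs = m := by omega
    have h1 : min (x / 2 ^ j) 1 ^ 2 ≤ 1 := pow_le_one₀ hm0 (min_le_right _ _)
    rw [zpow_add₀ two_ne_zero, zpow_natCast] at hn1
    rw [e, one_div, inv_pow, ← div_eq_mul_inv, le_div_iff₀ (by positivity)]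
    calc (2 : ℝ) ^ j * min (x / 2 ^ j) 1 ^ 2 * 2 ^ m ≤ 2 ^ j * 1 * 2 ^ m := by gcongr
      _ ≤ 2 * x := by linarith
  · obtain ⟨m, rfl⟩ : ∃ m : ℕ, j = n + m := ⟨(j - n).toNat, by omega⟩
    have e : (n + m - n).natAbs = m := by omega
    have h1 : min (x / 2 ^ (n + m : ℤ)) 1 ^ 2 ≤ (x / 2 ^ (n + m : ℤ)) ^ 2 :=
      pow_le_pow_left₀ hm0 (min_le_left _ _) 2
    rw [zpow_add_one₀ two_ne_zero] at hn2
    rw [e, one_div, inv_pow, ← div_eq_mul_inv]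
    refine (mul_le_mul_of_nonneg_left h1 hj.le).trans ?_
    have hN : (0 : ℝ) < 2 ^ n := by positivity
    rw [zpow_add₀ two_ne_zero, zpow_natCast]
    have e2 : (2 : ℝ) ^ n * 2 ^ m * (x / (2 ^ n * 2 ^ m)) ^ 2 = x / 2 ^ n * x / 2 ^ m := by
      field_simp
    rw [e2]
    gcongr
    rw [div_le_iff₀ hN]
    linarith

theorem dyadic_sum_min_sq_le (J : Finset ℤ) {x : ℝ} (hx : 0 ≤ x) :
    ∑ j ∈ J, (2 : ℝ) ^ j * min (x / 2 ^ j) 1 ^ 2 ≤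
      2 * (∑' j : ℤ, (1 / 2 : ℝ) ^ j.natAbs) * x := by
  rcases hx.eq_or_lt with h0 | hx
  · rw [← h0, mul_zero]
    refine (Finset.sum_eq_zero fun j _ => ?_).le
    rw [zero_div, min_eq_left zero_le_one, zero_pow two_ne_zero, mul_zero]
  obtain ⟨n, hn1, hn2⟩ := exists_mem_Ico_zpow hx (one_lt_two : (1 : ℝ) < 2)
  have hs : Summable fun j : ℤ => (1 / 2 : ℝ) ^ (j - n).natAbs :=
    by
    simpa only [Function.comp_def, Equiv.subRight_apply] using
      summable_half_pow_natAbs.comp_injective (Equiv.subRight n).injective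
  have ht : ∑' j : ℤ, (1 / 2 : ℝ) ^ (j - n).natAbs = ∑' j : ℤ, (1 / 2 : ℝ) ^ j.natAbs :=
    (Equiv.subRight n).tsum_eq fun j : ℤ => (1 / 2 : ℝ) ^ j.natAbs
  have h1 := Finset.sum_le_sum fun j (_ : j ∈ J) => dyadic_mul_min_sq_le hx hn1 hn2 j
  have h2 : ∑ j ∈ J, (1 / 2 : ℝ) ^ (j - n).natAbs ≤ ∑' j : ℤ, (1 / 2 : ℝ) ^ (j - n).natAbs :=
    hs.sum_le_tsum _ fun j _ => by positivity
  rw [← Finset.mul_sum] at h1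
  rw [ht] at h2
  have h3 := mul_le_mul_of_nonneg_left h2 (by positivity : 0 ≤ 2 * x)
  refine (h1.trans h3).trans_eq ?_
  ring

end Reals

/-! ### Continuous functional calculus and quadratic forms. -/

section Calculus

variable {H : Type*} [NormedAddCommGroup H] [InnerProductSpace ℂ H]

theorem re_inner_mono {S T : H →L[ℂ] H} (h : S ≤ T) (x : H) :
    (⟪x, S x⟫_ℂ).re ≤ (⟪x, T x⟫_ℂ).re := by
  have := ((ContinuousLinearMap.le_def S T).1 h).re_inner_nonneg_right x
  simpa [inner_sub_right] using this

variable [CompleteSpace H]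

/-- Self-adjointness of `f(A)` moves one factor across the inner product; norm bounds thereby reduce
to scalar inequalities on the spectrum. -/
theorem norm_sq_cfc_apply {A : H →L[ℂ] H} (hA : 0 ≤ A) (f : ℝ → ℝ) (hf : Continuous f) (x : H) :
    ‖cfc f A x‖ ^ 2 = (⟪x, cfc (fun t => f t ^ 2) A x⟫_ℂ).re := by
  have hA' : IsSelfAdjoint A := IsSelfAdjoint.of_nonneg hA
  have hsa : IsSelfAdjoint (cfc f A) := cfc_predicate f A
  rw [cfc_pow f 2 A (hf.continuousOn), pow_two (cfc f A)]
  change _ = (⟪x, cfc f A (cfc f A x)⟫_ℂ).re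
  rw [← ContinuousLinearMap.adjoint_inner_left, ← ContinuousLinearMap.star_eq_adjoint,
    hsa.star_eq, inner_self_eq_norm_sq_to_K]
  norm_cast

theorem re_inner_cfc_mono {A : H →L[ℂ] H} (hA : 0 ≤ A) {f g : ℝ → ℝ} (hf : Continuous f)
    (hg : Continuous g) (h : ∀ t, 0 ≤ t → f t ≤ g t) (x : H) :
    (⟪x, cfc f A x⟫_ℂ).re ≤ (⟪x, cfc g A x⟫_ℂ).re :=
  re_inner_mono (cfc_mono (fun t ht => h t (spectrum_nonneg_of_nonneg hA ht))
    hf.continuousOn hg.continuousOn) x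

theorem re_inner_cfc_le_mul {A : H →L[ℂ] H} (hA : 0 ≤ A) {f : ℝ → ℝ} (hf : Continuous f)
    {c : ℝ} (h : ∀ t, 0 ≤ t → f t ≤ c * t) (x : H) :
    (⟪x, cfc f A x⟫_ℂ).re ≤ c * (⟪x, A x⟫_ℂ).re := by
  have hsa : IsSelfAdjoint A := IsSelfAdjoint.of_nonneg hA
  have := re_inner_cfc_mono hA hf (by fun_prop : Continuous fun t : ℝ => c * t) h x
  rw [cfc_const_mul c (fun t => t) A, cfc_id' ℝ A] at this
  simpa using this

theorem map_mem_orthogonal_ker {A T : H →L[ℂ] H} (hT : IsSelfAdjoint T) (h : Commute T A)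
    {x : H} (hx : x ∈ (LinearMap.ker A.toLinearMap)ᗮ) :
    T x ∈ (LinearMap.ker A.toLinearMap)ᗮ := by
  intro y hy
  have hy' : A y = 0 := hy
  rw [← ContinuousLinearMap.adjoint_inner_left, ← ContinuousLinearMap.star_eq_adjoint,
    hT.star_eq]
  refine hx _ ?_
  change A (T y) = 0
  have : T (A y) = A (T y) := congrArg (fun S : H →L[ℂ] H => S y) h.eq
  rw [← this, hy', map_zero]

/-- The product of `(t - lam)₊` and `f` vanishes identically, so `f(A)` lands in the kernel defining
the subspace; no Borel calculus is needed. -/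
theorem cfc_apply_mem_spectralSubspace {A : H →L[ℂ] H} (hA : 0 ≤ A) {f : ℝ → ℝ}
    (hf : Continuous f) {lam : ℝ} (h : ∀ t, lam ≤ t → f t = 0) {x : H}
    (hx : x ∈ (LinearMap.ker A.toLinearMap)ᗮ) : cfc f A x ∈ spectralSubspace A lam := by
  have hsa : IsSelfAdjoint A := IsSelfAdjoint.of_nonneg hA
  refine ⟨?_, map_mem_orthogonal_ker (cfc_predicate f A)
    ((Commute.refl A).cfc_real f) hx⟩
  change cfc (fun t : ℝ => max (t - lam) 0) A (cfc f A x) = 0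
  have h0 : (fun t : ℝ => max (t - lam) 0 * f t) = fun _ => 0 := by
    funext t
    rcases le_total lam t with ht | ht
    · rw [h t ht, mul_zero]
    · rw [max_eq_right (by linarith), zero_mul]
  change (cfc (fun t : ℝ => max (t - lam) 0) A * cfc f A) x = 0
  rw [← cfc_mul (fun t : ℝ => max (t - lam) 0) f A
    (by fun_prop) hf.continuousOn, h0]
  simp

end Calculus

/-! ### Dyadic spectral cutoffs and the Sobolev inequality. -/

section Sobolev

open Filter Topology

section Cutoffs

variable {H : Type*} [NormedAddCommGroup H] [InnerProductSpace ℂ H] [CompleteSpace H]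

/-- The smoothed spectral projection `(1 - min(A / λ, 1))`, which cuts off energies above `λ`. -/
noncomputable def lowPass (A : H →L[ℂ] H) (lam : ℝ) : H →L[ℂ] H := cfc (fun t : ℝ => 1 - min (t / lam) 1) A

/-- The complementary cutoff `min(A / λ, 1)`. -/
noncomputable def highPass (A : H →L[ℂ] H) (lam : ℝ) : H →L[ℂ] H := cfc (fun t : ℝ => min (t / lam) 1) A

theorem lowPass_add_highPass {A : H →L[ℂ] H} (hA : 0 ≤ A) (lam : ℝ) (x : H) :
    lowPass A lam x + highPass A lam x = x := by
  have hsa : IsSelfAdjoint A := IsSelfAdjoint.of_nonneg hA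
  rw [lowPass, highPass, cfc_sub (fun _ => (1 : ℝ)) (fun t => min (t / lam) 1) A
    (by fun_prop) (by fun_prop), cfc_const_one ℝ A]
  simp

theorem lowPass_mem_spectralSubspace {A : H →L[ℂ] H} (hA : 0 ≤ A) {lam : ℝ} (hl : 0 < lam) {x : H}
    (hx : x ∈ (LinearMap.ker A.toLinearMap)ᗮ) : lowPass A lam x ∈ spectralSubspace A lam := by
  refine cfc_apply_mem_spectralSubspace hA (by fun_prop) (fun t ht => ?_) hx
  rw [min_eq_right ((one_le_div hl).2 ht), sub_self]

theorem norm_lowPass_le {A : H →L[ℂ] H} (hA : 0 ≤ A) {lam : ℝ} (hl : 0 < lam) (x : H) :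
    ‖lowPass A lam x‖ ≤ ‖x‖ := by
  have hsa : IsSelfAdjoint A := IsSelfAdjoint.of_nonneg hA
  refine le_of_sq_le_sq ?_ (norm_nonneg _)
  rw [lowPass, norm_sq_cfc_apply hA _ (by fun_prop)]
  refine (re_inner_cfc_mono hA (g := fun _ => 1) (by fun_prop) (by fun_prop) (fun t ht => ?_)
    x).trans_eq ?_
  · have h1 : 0 ≤ min (t / lam) 1 := le_min (by positivity) zero_le_one
    have h2 : min (t / lam) 1 ≤ 1 := min_le_right _ _
    exact pow_le_one₀ (by linarith) (by linarith)
  · rw [cfc_const_one ℝ A, one_apply_eq_self, inner_self_eq_norm_sq_to_K]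
    norm_cast

/-- Both ramps vanish beyond `lam`, and their difference `g` satisfies `0 ≤ g ≤ 1` and `g ≤ 2t/lam`,
hence `g² ≤ 2t/lam`. -/
theorem lowPass_sub_mem_spectralSubspace {A : H →L[ℂ] H} (hA : 0 ≤ A) {lam : ℝ} (hl : 0 < lam)
    {x : H} (hx : x ∈ (LinearMap.ker A.toLinearMap)ᗮ) :
    lowPass A lam x - lowPass A (lam / 2) x ∈ spectralSubspace A lam ∧
      ‖lowPass A lam x - lowPass A (lam / 2) x‖ ^ 2 ≤ 2 / lam * (⟪x, A x⟫_ℂ).re := by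
  have hsa : IsSelfAdjoint A := IsSelfAdjoint.of_nonneg hA
  have e : lowPass A lam x - lowPass A (lam / 2) x =
      cfc (fun t : ℝ => (1 - min (t / lam) 1) - (1 - min (t / (lam / 2)) 1)) A x := by
    rw [cfc_sub (fun t : ℝ => 1 - min (t / lam) 1) (fun t : ℝ => 1 - min (t / (lam / 2)) 1) A
      (by fun_prop) (by fun_prop)]
    rfl
  rw [e]
  refine ⟨cfc_apply_mem_spectralSubspace hA (by fun_prop) (fun t ht => ?_) hx, ?_⟩
  · rw [min_eq_right ((one_le_div hl).2 ht),
      min_eq_right ((one_le_div (half_pos hl)).2 (by linarith)), sub_self]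
  · rw [norm_sq_cfc_apply hA _ (by fun_prop)]
    refine re_inner_cfc_le_mul hA (by fun_prop) (fun t ht => ?_) x
    have h0 : 0 ≤ min (t / lam) 1 := le_min (by positivity) zero_le_one
    have h1 : min (t / lam) 1 ≤ min (t / (lam / 2)) 1 :=
      min_le_min_right _ (div_le_div_of_nonneg_left ht (half_pos hl) (by linarith))
    have h2 : min (t / (lam / 2)) 1 ≤ 1 := min_le_right _ _
    have h3 : min (t / (lam / 2)) 1 ≤ 2 / lam * t := (min_le_left _ _).trans_eq (by field_simp)
    nlinarith

/-- The square-function estimate: `∑ 2^j min(t/2^j, 1)² ≤ K t` applied to `A`, with `K` independent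
of `A` and of the set of scales. -/
theorem exists_sum_norm_highPass_sq_le : ∃ K : ℝ, 0 ≤ K ∧
    ∀ {A : H →L[ℂ] H} (_ : 0 ≤ A) (J : Finset ℤ) (x : H),
    ∑ j ∈ J, (2 : ℝ) ^ j * ‖highPass A (2 ^ j) x‖ ^ 2 ≤ K * (⟪x, A x⟫_ℂ).re := by
  refine ⟨2 * (∑' j : ℤ, (1 / 2 : ℝ) ^ j.natAbs),
    mul_nonneg zero_le_two (tsum_nonneg fun j => by positivity), fun {A} hA J x => ?_⟩
  have hsa : IsSelfAdjoint A := IsSelfAdjoint.of_nonneg hA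
  have hc : ∀ j : ℤ, Continuous fun t : ℝ => (2 : ℝ) ^ j * min (t / 2 ^ j) 1 ^ 2 := fun j => by
    fun_prop
  have e : ∑ j ∈ J, (2 : ℝ) ^ j * ‖highPass A (2 ^ j) x‖ ^ 2 =
      (⟪x, cfc (fun t => ∑ j ∈ J, (2 : ℝ) ^ j * min (t / 2 ^ j) 1 ^ 2) A x⟫_ℂ).re := by
    have hfun : (fun t => ∑ j ∈ J, (2 : ℝ) ^ j * min (t / 2 ^ j) 1 ^ 2) =
        ∑ j ∈ J, fun t : ℝ => (2 : ℝ) ^ j * min (t / 2 ^ j) 1 ^ 2 :=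
      (Finset.sum_fn J fun (j : ℤ) (t : ℝ) => (2 : ℝ) ^ j * min (t / 2 ^ j) 1 ^ 2).symm
    rw [hfun, cfc_sum _ A J fun j _ => (hc j).continuousOn, sum_apply,
      inner_sum, Complex.re_sum]
    refine Finset.sum_congr rfl fun j _ => ?_
    rw [cfc_const_mul ((2 : ℝ) ^ j) (fun t : ℝ => min (t / 2 ^ j) 1 ^ 2) A (by fun_prop), highPass,
      norm_sq_cfc_apply hA _ (by fun_prop), _root_.smul_apply, inner_smul_right_eq_smul,
      Complex.real_smul, Complex.re_ofReal_mul]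
  rw [e]
  exact re_inner_cfc_le_mul hA (continuous_finsetSum _ fun j _ => hc j)
    (fun t ht => dyadic_sum_min_sq_le J ht) x

end Cutoffs

variable {ι : Type*} {A : lp (fun _ : ι => ℂ) 2 →L[ℂ] lp (fun _ : ι => ℂ) 2} {α c : ℝ}

/-- Each increment costs `λ^(α/4)` from ultracontractivity and gains `λ^(-1/2)` from the energy; the
net exponent `(α - 2)/4` is positive. -/
theorem norm_lowPass_apply_le (hA : 0 ≤ A) (hα : 2 < α) (hc : 0 ≤ c)
    (h : ∀ lam : ℝ, 0 < lam → ∀ w ∈ spectralSubspace A lam, ∀ i,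
      ‖w i‖ ≤ c * lam ^ (α / 4) * ‖w‖)
    {x : lp (fun _ : ι => ℂ) 2} (hx : x ∈ (LinearMap.ker A.toLinearMap)ᗮ) (i : ι) (j : ℤ) :
    ‖lowPass A (2 ^ j) x i‖ ≤ c * √2 * √(⟪x, A x⟫_ℂ).re *
      ((2 : ℝ) ^ ((α - 2) / 4) / ((2 : ℝ) ^ ((α - 2) / 4) - 1)) *
        ((2 : ℝ) ^ ((α - 2) / 4)) ^ j := by
  have hr : (1 : ℝ) < (2 : ℝ) ^ ((α - 2) / 4) :=
    Real.one_lt_rpow one_lt_two (by linarith)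
  refine le_geometric_of_increment_le (a := fun j : ℤ => ‖lowPass A (2 ^ j) x i‖) hr
    (fun j => ?_) ?_ j
  · have hl : (0 : ℝ) < 2 ^ j := by positivity
    obtain ⟨h1, h2⟩ := lowPass_sub_mem_spectralSubspace hA hl hx
    have h3 := h _ hl _ h1 i
    rw [zpow_sub_one₀ two_ne_zero, ← div_eq_mul_inv]
    have h4 : ‖lowPass A (2 ^ j) x - lowPass A (2 ^ j / 2) x‖ ≤
        √2 * √(⟪x, A x⟫_ℂ).re * ((2 : ℝ) ^ j) ^ (-(1 / 2) : ℝ) := by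
      refine (Real.le_sqrt_of_sq_le h2).trans_eq ?_
      rw [Real.sqrt_mul (by positivity), Real.sqrt_div zero_le_two, Real.rpow_neg hl.le,
        ← Real.sqrt_eq_rpow]
      ring
    have h5 : ((2 : ℝ) ^ j) ^ (α / 4) * ((2 : ℝ) ^ j) ^ (-(1 / 2) : ℝ) =
        ((2 : ℝ) ^ ((α - 2) / 4)) ^ j := by
      rw [← Real.rpow_add hl, ← Real.rpow_intCast, ← Real.rpow_intCast, ← Real.rpow_mul zero_le_two,
        ← Real.rpow_mul zero_le_two]
      congr 1
      ring
    have h6 : ‖lowPass A (2 ^ j) x i‖ ≤ ‖lowPass A (2 ^ j / 2) x i‖ +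
        ‖(lowPass A (2 ^ j) x - lowPass A (2 ^ j / 2) x) i‖ := by
      refine (norm_le_insert' _ (lowPass A (2 ^ j / 2) x i)).trans_eq ?_
      rfl
    refine h6.trans (add_le_add_right (h3.trans ?_) _)
    calc _ ≤ c * ((2 : ℝ) ^ j) ^ (α / 4) *
          (√2 * √(⟪x, A x⟫_ℂ).re * ((2 : ℝ) ^ j) ^ (-(1 / 2) : ℝ)) := by gcongr
      _ = c * √2 * √(⟪x, A x⟫_ℂ).re *
          (((2 : ℝ) ^ j) ^ (α / 4) * ((2 : ℝ) ^ j) ^ (-(1 / 2) : ℝ)) := by ring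
      _ = _ := by rw [h5]
  -- Ultracontractivity applied to the whole low part, with `‖lowPass‖ ≤ 1`, forces its values to
  -- vanish as the scale tends to `0`.
  · have h1 : Tendsto (fun j : ℤ => c * ((2 : ℝ) ^ j) ^ (α / 4) * ‖x‖) atBot (𝓝 0) := by
      have := (tendsto_zpow_atBot_zero one_lt_two).rpow_const (p := α / 4)
        (Or.inr (by linarith))
      rw [Real.zero_rpow (by linarith)] at this
      simpa using (this.const_mul c).mul_const ‖x‖
    refine squeeze_zero (fun _ => norm_nonneg _) (fun j => ?_) h1
    have hl : (0 : ℝ) < 2 ^ j := by positivity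
    refine (h _ hl _ (lowPass_mem_spectralSubspace hA hl hx) i).trans ?_
    have := norm_lowPass_le hA hl x
    gcongr

/-- The Sobolev inequality for an operator whose spectral subspaces are ultracontractive. -/
theorem exists_sum_rpow_le (hA : 0 ≤ A) (hα : 2 < α) (hc : 0 ≤ c)
    (h : ∀ lam : ℝ, 0 < lam → ∀ w ∈ spectralSubspace A lam, ∀ i,
      ‖w i‖ ≤ c * lam ^ (α / 4) * ‖w‖) :
    ∃ K : ℝ, 0 ≤ K ∧ ∀ x ∈ (LinearMap.ker A.toLinearMap)ᗮ, ∀ T : Finset ι,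
      ∑ i ∈ T, ‖x i‖ ^ (2 * α / (α - 2)) ≤
        (K * √(⟪x, A x⟫_ℂ).re) ^ (2 * α / (α - 2)) := by
  obtain ⟨K, hK, hsum⟩ := exists_sum_norm_highPass_sq_le (H := lp (fun _ : ι => ℂ) 2)
  set s := (α - 2) / 4 with hs
  set q := 2 * α / (α - 2) with hq
  have hα2 : α - 2 ≠ 0 := by linarith
  have hspos : 0 < s := by rw [hs]; linarith
  -- This relation determines `q`: it converts `(r ^ j) ^ (q - 2)` into `2 ^ j`, the weight in the
  -- square-function estimate.
  have hqs : s * (q - 2) = 1 := by rw [hs, hq]; field_simp; ring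
  have hq2 : 0 < q - 2 := by
    by_contra hneg
    nlinarith
  set r := (2 : ℝ) ^ s with hr_def
  have hr : 1 < r := Real.one_lt_rpow one_lt_two hspos
  -- the constant is made positive, as `c` may vanish
  set M := (c + 1) * √2 * (r / (r - 1)) with hM
  have hMpos : 0 < M := by
    have : 0 < r - 1 := by linarith
    positivity
  refine ⟨(4 * (2 * M * r) ^ (q - 2) * K) ^ (1 / q), by positivity, fun x hx T => ?_⟩
  set E := (⟪x, A x⟫_ℂ).re with hE
  have hE0 : 0 ≤ E := by
    simpa using ((ContinuousLinearMap.nonneg_iff_isPositive A).1 hA).re_inner_nonneg_right x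
  set D := √E with hD
  have hlow : ∀ i (j : ℤ), ‖lowPass A (2 ^ j) x i‖ ≤ M * D * r ^ j := fun i j => by
    refine (norm_lowPass_apply_le hA hα hc h hx i j).trans ?_
    have h1 : 0 < r - 1 := by linarith
    calc c * √2 * D * (r / (r - 1)) * r ^ j ≤ (c + 1) * √2 * D * (r / (r - 1)) * r ^ j := by
          gcongr; linarith
      _ = M * D * r ^ j := by rw [hM]; ring
  have hqpos : 0 < q := by linarith
  have hRHS : ((4 * (2 * M * r) ^ (q - 2) * K) ^ (1 / q) * D) ^ q =
      4 * (2 * M * r) ^ (q - 2) * K * D ^ q := by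
    rw [Real.mul_rpow (by positivity) (by positivity), ← Real.rpow_mul (by positivity),
      one_div_mul_cancel hqpos.ne', Real.rpow_one]
  rw [hRHS]
  -- Zero energy is treated apart, since the choice of scale below divides by `D`; both parts of `x`
  -- at scale `1` then vanish.
  rcases hE0.eq_or_lt with hE0 | hEpos
  · have h1 : highPass A (2 ^ (0 : ℤ)) x = 0 := by
      have := hsum hA {0} x
      rw [← hE, ← hE0, mul_zero, Finset.sum_singleton, zpow_zero, one_mul] at this
      rw [zpow_zero]
      exact norm_eq_zero.1 (sq_eq_zero_iff.1 (this.antisymm (sq_nonneg _)))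
    have h2 : ∀ i ∈ T, ‖x i‖ ^ q = 0 := fun i _ => by
      have h3 := hlow i 0
      rw [hD, ← hE0, Real.sqrt_zero, mul_zero, zero_mul] at h3
      have h4 := lowPass_add_highPass hA (2 ^ (0 : ℤ)) x
      rw [h1, add_zero] at h4
      rw [h4] at h3
      rw [h3.antisymm (norm_nonneg _), Real.zero_rpow hqpos.ne']
    rw [Finset.sum_eq_zero h2]
    positivity
  have hDpos : 0 < D := Real.sqrt_pos.2 hEpos
  have hpt : ∀ i, ∃ j : ℤ, ‖x i‖ ^ q ≤
      4 * (2 * M * D * r) ^ (q - 2) * (2 ^ j * ‖highPass A (2 ^ j) x i‖ ^ 2) := by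
    intro i
    rcases (norm_nonneg (x i)).eq_or_lt with h0 | hpos
    · exact ⟨0, by rw [← h0, Real.zero_rpow hqpos.ne']; positivity⟩
    have hMD : 0 < 2 * M * D := by positivity
    -- With `r ^ j ≤ |x i| / (2MD) < r ^ (j + 1)`, the lower inequality makes the low part at most
    -- `|x i| / 2`, and the upper one bounds `|x i| ^ (q - 2)` by a multiple of `2 ^ j`.
    obtain ⟨j, hj1, hj2⟩ := exists_mem_Ico_zpow (div_pos hpos hMD) hr
    rw [le_div_iff₀ hMD] at hj1
    rw [div_lt_iff₀ hMD] at hj2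
    refine ⟨j, ?_⟩
    have h1 : ‖x i‖ ≤ ‖lowPass A (2 ^ j) x i‖ + ‖highPass A (2 ^ j) x i‖ := by
      refine le_trans (le_of_eq ?_) (norm_add_le _ _)
      nth_rewrite 1 [← lowPass_add_highPass hA (2 ^ j) x]
      rfl
    have h2 : ‖x i‖ ≤ 2 * ‖highPass A (2 ^ j) x i‖ := by
      have := hlow i j
      nlinarith
    have h3 : ‖x i‖ ^ (q - 2) ≤ (2 * M * D * r) ^ (q - 2) * 2 ^ j := by
      have hrj : (r ^ j) ^ (q - 2) = 2 ^ j := by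
        rw [hr_def, ← Real.rpow_intCast, ← Real.rpow_intCast, ← Real.rpow_mul zero_le_two,
          ← Real.rpow_mul zero_le_two]
        congr 1
        linear_combination (j : ℝ) * hqs
      rw [← hrj, ← Real.mul_rpow (by positivity) (by positivity)]
      refine Real.rpow_le_rpow hpos.le (hj2.le.trans_eq ?_) hq2.le
      rw [zpow_add_one₀ (by positivity)]
      ring
    calc ‖x i‖ ^ q = ‖x i‖ ^ (q - 2) * ‖x i‖ ^ 2 := by
          rw [← Real.rpow_natCast, ← Real.rpow_add hpos]
          congr 1
          push_cast
          ring
      _ ≤ ((2 * M * D * r) ^ (q - 2) * 2 ^ j) * (2 * ‖highPass A (2 ^ j) x i‖) ^ 2 := by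
          gcongr
      _ = _ := by ring
  choose J hJ using hpt
  have hsq : ∀ j : ℤ, ∑ i ∈ T, ‖highPass A (2 ^ j) x i‖ ^ 2 ≤ ‖highPass A (2 ^ j) x‖ ^ 2 :=
    fun j => by
      have := lp.sum_rpow_le_norm_rpow (p := 2) (by norm_num) (highPass A (2 ^ j) x) T
      simpa using this
  classical
  -- The scale depends on `i`; replacing it by the sum over all scales used allows the two sums to
  -- be exchanged.
  calc ∑ i ∈ T, ‖x i‖ ^ q
      ≤ ∑ i ∈ T, 4 * (2 * M * D * r) ^ (q - 2) *
          ∑ j ∈ T.image J, 2 ^ j * ‖highPass A (2 ^ j) x i‖ ^ 2 := by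
        refine Finset.sum_le_sum fun i hi => (hJ i).trans ?_
        refine mul_le_mul_of_nonneg_left ?_ (by positivity)
        exact Finset.single_le_sum (f := fun j : ℤ => (2 : ℝ) ^ j * ‖highPass A (2 ^ j) x i‖ ^ 2)
          (fun j _ => by positivity) (Finset.mem_image_of_mem J hi)
    _ = 4 * (2 * M * D * r) ^ (q - 2) *
          ∑ j ∈ T.image J, 2 ^ j * ∑ i ∈ T, ‖highPass A (2 ^ j) x i‖ ^ 2 := by
        rw [← Finset.mul_sum, Finset.sum_comm]
        simp_rw [Finset.mul_sum]
    _ ≤ 4 * (2 * M * D * r) ^ (q - 2) * (K * E) := by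
        refine mul_le_mul_of_nonneg_left ?_ (by positivity)
        refine le_trans (Finset.sum_le_sum fun j _ => ?_) (hsum hA (T.image J) x)
        exact mul_le_mul_of_nonneg_left (hsq j) (by positivity)
    _ = 4 * (2 * M * r) ^ (q - 2) * K * D ^ q := by
        have e1 : 2 * M * D * r = 2 * M * r * D := by ring
        have e2 : D ^ q = D ^ (q - 2) * E := by
          rw [← Real.sq_sqrt hE0, ← hD, ← Real.rpow_natCast D 2, ← Real.rpow_add hDpos]
          congr 1
          push_cast
          ring
        rw [e1, Real.mul_rpow (by positivity) hDpos.le, e2]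
        ring

end Sobolev

/-! ### Deck transformations and pointwise bounds from the von Neumann dimension. -/

section Equivariance

theorem map_mem_spectralSubspace {H : Type*} [NormedAddCommGroup H] [InnerProductSpace ℂ H]
    [CompleteSpace H] {A : H →L[ℂ] H} (U : H ≃ₗᵢ[ℂ] H) (hU : ∀ x, A (U x) = U (A x)) {lam : ℝ}
    {x : H} (hx : x ∈ spectralSubspace A lam) : U x ∈ spectralSubspace A lam := by
  let T : H →L[ℂ] H := U.toContinuousLinearEquiv.toContinuousLinearMap
  have hT : Commute A T := ContinuousLinearMap.ext hU
  refine ⟨?_, fun y hy => ?_⟩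
  · have h1 : cfc (fun t : ℝ => max (t - lam) 0) A x = 0 := hx.1
    have h2 := congrArg (fun S : H →L[ℂ] H => S x)
      (hT.cfc_real fun t : ℝ => max (t - lam) 0).eq
    change cfc (fun t : ℝ => max (t - lam) 0) A (U x) =
      U (cfc (fun t : ℝ => max (t - lam) 0) A x) at h2
    rw [h1, map_zero] at h2
    exact h2
  · have hy0 : A y = 0 := hy
    have h1 : A (U.symm y) = 0 := by
      apply U.injective
      rw [← hU, U.apply_symm_apply, hy0, map_zero]
    have h2 := hx.2 (U.symm y) h1
    rwa [← U.inner_map_map, U.apply_symm_apply] at h2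

theorem adjoint_comp_self_commute {H H' : Type*} [NormedAddCommGroup H] [InnerProductSpace ℂ H]
    [CompleteSpace H] [NormedAddCommGroup H'] [InnerProductSpace ℂ H'] [CompleteSpace H']
    {D : H →L[ℂ] H'} (U : H ≃ₗᵢ[ℂ] H) (U' : H' ≃ₗᵢ[ℂ] H') (hU : ∀ x, D (U x) = U' (D x)) (x : H) :
    (D.adjoint ∘L D) (U x) = U ((D.adjoint ∘L D) x) := by
  refine ext_inner_right ℂ fun y => ?_
  obtain ⟨z, rfl⟩ := U.surjective y
  rw [U.inner_map_map, ContinuousLinearMap.comp_apply, ContinuousLinearMap.comp_apply,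
    ContinuousLinearMap.adjoint_inner_left, ContinuousLinearMap.adjoint_inner_left, hU, hU,
    U'.inner_map_map]

theorem memℓp_two_comp {ι : Type*} (e : ι ≃ ι) (f : lp (fun _ : ι => ℂ) 2) :
    Memℓp (fun i => f (e i)) 2 := by
  have h := (lp.memℓp f).summable (by norm_num)
  exact memℓp_gen ((e.summable_iff).2 h)

/-- Reindexing of `ℓ²(ι)` by a permutation of `ι`. -/
noncomputable def lpReindex {ι : Type*} (e : ι ≃ ι) :
    lp (fun _ : ι => ℂ) 2 ≃ₗᵢ[ℂ] lp (fun _ : ι => ℂ) 2 where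
  toFun f := ⟨fun i => f (e i), memℓp_two_comp e f⟩
  invFun f := ⟨fun i => f (e.symm i), memℓp_two_comp e.symm f⟩
  map_add' _ _ := rfl
  map_smul' _ _ := rfl
  left_inv f := lp.ext (funext fun i => congrArg (⇑f) (e.apply_symm_apply i))
  right_inv f := lp.ext (funext fun i => congrArg (⇑f) (e.symm_apply_apply i))
  norm_map' f := by
    have h1 := lp.norm_rpow_eq_tsum (p := 2) (by norm_num) f
    have h2 := lp.norm_rpow_eq_tsum (p := 2) (by norm_num)
      (⟨fun i => f (e i), memℓp_two_comp e f⟩ : lp (fun _ : ι => ℂ) 2)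
    have h3 := e.tsum_eq fun i => ‖f i‖ ^ (2 : ℝ≥0∞).toReal
    have h4 := h2.trans (h3.trans h1.symm)
    exact (Real.rpow_left_inj (norm_nonneg _) (norm_nonneg _) (by norm_num)).1 h4

theorem lpReindex_apply {ι : Type*} (e : ι ≃ ι) (f : lp (fun _ : ι => ℂ) 2) (i : ι) :
    lpReindex e f i = f (e i) := rfl

variable {Γ V W : Type*} [Group Γ] [MulAction Γ V] [LinearOrder W]
  {X : AbstractSimplicialComplex V} {K : AbstractSimplicialComplex W} {π : V → W}

/-- The action of a deck transformation on simplices. -/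
def simplexPerm (hπ : IsGaloisCovering Γ X K π) (γ : Γ) (k : ℕ) :
    Simplices X k ≃ Simplices X k where
  toFun σ := ⟨σ.1.map (MulAction.toPerm γ).toEmbedding, hπ.smul_mem γ _ σ.2.1, by
    rw [Finset.card_map, σ.2.2]⟩
  invFun σ := ⟨σ.1.map (MulAction.toPerm γ⁻¹).toEmbedding, hπ.smul_mem γ⁻¹ _ σ.2.1, by
    rw [Finset.card_map, σ.2.2]⟩
  left_inv σ := Subtype.ext (by ext; simp)
  right_inv σ := Subtype.ext (by ext; simp)

theorem simplexPerm_coe (hπ : IsGaloisCovering Γ X K π) (γ : Γ) (k : ℕ) (σ : Simplices X k) :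
    (simplexPerm hπ γ k σ).1 = σ.1.map (MulAction.toPerm γ).toEmbedding := rfl

theorem smul_mem_simplexPerm {hπ : IsGaloisCovering Γ X K π} {γ : Γ} {k : ℕ} {σ : Simplices X k}
    {v : V} : γ • v ∈ (simplexPerm hπ γ k σ).1 ↔ v ∈ σ.1 := by
  simp [simplexPerm_coe]

variable [DecidableEq V]

/-- Deck transformations preserve `π`, hence the vertex order and the incidence signs. -/
theorem coboundary_comp_simplexPerm (hπ : IsGaloisCovering Γ X K π) (γ : Γ) (k : ℕ)
    (f : Simplices X k → ℂ) (τ : Simplices X (k + 1)) :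
    coboundary π (fun σ => f (simplexPerm hπ γ k σ)) τ =
      coboundary π f (simplexPerm hπ γ (k + 1) τ) := by
  have hinv : ∀ v : V, π (γ • v) = π v := fun v => ((hπ.fibre v (γ • v)).2 ⟨γ, rfl⟩).symm
  refine Fintype.sum_equiv
    ((MulAction.toPerm γ).subtypeEquiv fun v => smul_mem_simplexPerm.symm) _ _ fun v => ?_
  have h1 : (simplexPerm hπ γ (k + 1) τ).1.filter (fun u => π u < π (γ • v.1)) =
      (τ.1.filter fun u => π u < π v).map (MulAction.toPerm γ).toEmbedding := by
    rw [hinv]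
    simp [simplexPerm_coe, Finset.filter_map, hinv]
  have h2 : oppositeFace (simplexPerm hπ γ (k + 1) τ) (γ • v.1) (smul_mem_simplexPerm.2 v.2) =
      simplexPerm hπ γ k (oppositeFace τ v v.2) := by
    exact Subtype.ext (Finset.map_erase (MulAction.toPerm γ).toEmbedding τ.1 v.1).symm
  change _ = (-1 : ℂ) ^ ((simplexPerm hπ γ (k + 1) τ).1.filter
    (fun u => π u < π (γ • v.1))).card * f (oppositeFace _ (γ • v.1) _)
  rw [h1, h2, Finset.card_map]

variable [Finite W]

theorem coboundaryL2_lpReindex (hπ : IsGaloisCovering Γ X K π) (γ : Γ) (k : ℕ)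
    (f : LpCochains X k 2) :
    coboundaryL2 hπ.toIsCovering k (lpReindex (simplexPerm hπ γ k) f) =
      lpReindex (simplexPerm hπ γ (k + 1)) (coboundaryL2 hπ.toIsCovering k f) :=
  lp.ext (funext fun τ => coboundary_comp_simplexPerm hπ γ k (⇑f) τ)

/-- The combinatorial Laplacian `d_k^* d_k`. -/
noncomputable abbrev upLaplacian (hπ : IsCovering X K π) (k : ℕ) :
    LpCochains X k 2 →L[ℂ] LpCochains X k 2 :=
  (coboundaryL2 hπ k).adjoint ∘L coboundaryL2 hπ k

theorem upLaplacian_nonneg (hπ : IsCovering X K π) (k : ℕ) : 0 ≤ upLaplacian hπ k :=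
  (ContinuousLinearMap.nonneg_iff_isPositive _).2
    (ContinuousLinearMap.isPositive_adjoint_comp_self _)

theorem lpReindex_mem_spectralSubspace (hπ : IsGaloisCovering Γ X K π) (γ : Γ) {k : ℕ} {lam : ℝ}
    {w : LpCochains X k 2} (hw : w ∈ spectralSubspace (upLaplacian hπ.toIsCovering k) lam) :
    lpReindex (simplexPerm hπ γ k) w ∈ spectralSubspace (upLaplacian hπ.toIsCovering k) lam :=
  map_mem_spectralSubspace (lpReindex (simplexPerm hπ γ k))
    (adjoint_comp_self_commute (lpReindex (simplexPerm hπ γ k))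
      (lpReindex (simplexPerm hπ γ (k + 1))) (coboundaryL2_lpReindex hπ γ k)) hw

theorem norm_starProjection_single_sq {ι : Type*} [DecidableEq ι]
    (E : Submodule ℂ (lp (fun _ : ι => ℂ) 2)) [E.HasOrthogonalProjection] (i : ι) :
    ‖E.starProjection (lp.single 2 i (1 : ℂ))‖ ^ 2 =
      (⟪(lp.single 2 i (1 : ℂ) : lp (fun _ : ι => ℂ) 2),
        E.starProjection (lp.single 2 i (1 : ℂ))⟫_ℂ).re := by
  rw [← Submodule.inner_starProjection_left_eq_right]
  exact (Submodule.re_inner_starProjection_eq_normSq E _).symm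

theorem norm_apply_le_of_mem {ι : Type*} [DecidableEq ι]
    (E : Submodule ℂ (lp (fun _ : ι => ℂ) 2)) [E.HasOrthogonalProjection] (i : ι)
    {w : lp (fun _ : ι => ℂ) 2} (hw : w ∈ E) :
    ‖w i‖ ≤ ‖E.starProjection (lp.single 2 i (1 : ℂ))‖ * ‖w‖ := by
  have h1 : w i = ⟪E.starProjection (lp.single 2 i (1 : ℂ)), w⟫_ℂ := by
    rw [Submodule.inner_starProjection_left_eq_right, Submodule.starProjection_eq_self_iff.2 hw,
      lp.inner_single_left]
    simp
  rw [h1]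
  exact norm_inner_le_norm _ _

/-- A bound on the spectral density bounds the values of cochains in the spectral subspaces. -/
theorem norm_apply_le_of_spectralDensity_le (hπ : IsGaloisCovering Γ X K π) {k : ℕ} {lam B : ℝ}
    (hF : spectralDensity Γ hπ k lam ≤ ENNReal.ofReal B) {w : LpCochains X k 2}
    (hw : w ∈ spectralSubspace (upLaplacian hπ.toIsCovering k) lam) (σ : Simplices X k) :
    ‖w σ‖ ≤ √B * ‖w‖ := by
  let _ : DecidableEq (Simplices X k) := fun _ _ => Classical.propDecidable _
  let E := spectralSubspace (upLaplacian hπ.toIsCovering k) lam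
  let o : Quotient (simplexOrbit Γ X k) := Quotient.mk _ σ
  obtain ⟨γ, hγ⟩ : ∃ γ : Γ, o.out.1.map (MulAction.toPerm γ).toEmbedding = σ.1 :=
    Quotient.exact (Quotient.out_eq o)
  have h1 : ENNReal.ofReal (⟪(lp.single 2 o.out (1 : ℂ) : LpCochains X k 2),
      E.starProjection (lp.single 2 o.out (1 : ℂ))⟫_ℂ).re ≤ ENNReal.ofReal B := by
    refine le_trans ?_ hF
    exact ENNReal.le_tsum (f := fun o : Quotient (simplexOrbit Γ X k) =>
      ENNReal.ofReal (⟪(lp.single 2 o.out (1 : ℂ) : LpCochains X k 2),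
        E.starProjection (lp.single 2 o.out (1 : ℂ))⟫_ℂ).re) o
  rw [← norm_starProjection_single_sq] at h1
  have h2 : ‖E.starProjection (lp.single 2 o.out (1 : ℂ))‖ ≤ √B := by
    -- For `B ≤ 0` both `ENNReal.ofReal B` and `√B` are `0`, and the projected delta vanishes.
    rcases le_or_gt B 0 with hB | hB
    · rw [ENNReal.ofReal_of_nonpos hB, nonpos_iff_eq_zero, ENNReal.ofReal_eq_zero] at h1
      rw [sq_eq_zero_iff.1 (h1.antisymm (sq_nonneg _))]
      exact Real.sqrt_nonneg _
    · exact Real.le_sqrt_of_sq_le ((ENNReal.ofReal_le_ofReal_iff hB.le).1 h1)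
  -- The translate of `w` by `γ` stays in `E` with the same norm, and its value at the orbit
  -- representative is `w σ`.
  have h3 := norm_apply_le_of_mem E o.out (lpReindex_mem_spectralSubspace hπ γ hw)
  rw [LinearIsometryEquiv.norm_map, lpReindex_apply] at h3
  have h4 : simplexPerm hπ γ k o.out = σ := Subtype.ext hγ
  rw [h4] at h3
  exact h3.trans (mul_le_mul_of_nonneg_right h2 (norm_nonneg _))

end Equivariance

/-! ### Inclusions of sequence spaces and the Sobolev exponent. -/

section Embedding

/-- The embedding `ℓ^q ⊆ ℓ^p` for `q ≤ p ≤ ∞`, with norm at most one. -/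
theorem exists_lp_norm_le {ι : Type*} {x : ι → ℂ} {q B : ℝ} (hq : 0 < q) (hB : 0 ≤ B)
    (h : ∀ T : Finset ι, ∑ i ∈ T, ‖x i‖ ^ q ≤ B ^ q) {p : ℝ≥0∞} (hp : p = ⊤ ∨ q ≤ p.toReal) :
    ∃ b : lp (fun _ : ι => ℂ) p, ⇑b = x ∧ ‖b‖ ≤ B := by
  have hpt : ∀ i, ‖x i‖ ≤ B := fun i => by
    have := h {i}
    rw [Finset.sum_singleton] at this
    exact (Real.rpow_le_rpow_iff (norm_nonneg _) hB hq).1 this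
  rcases hp with rfl | hp
  · exact ⟨⟨x, memℓp_infty ⟨B, by rintro _ ⟨i, rfl⟩; exact hpt i⟩⟩, rfl,
      lp.norm_le_of_forall_le hB hpt⟩
  -- The sup bound gives `|x i|^p ≤ B^(p-q) |x i|^q`.
  · have hsum : ∀ T : Finset ι, ∑ i ∈ T, ‖x i‖ ^ p.toReal ≤ B ^ p.toReal := fun T => by
      have e : p.toReal = (p.toReal - q) + q := by ring
      calc ∑ i ∈ T, ‖x i‖ ^ p.toReal ≤ ∑ i ∈ T, B ^ (p.toReal - q) * ‖x i‖ ^ q := by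
            refine Finset.sum_le_sum fun i _ => ?_
            conv_lhs => rw [e]
            rw [Real.rpow_add_of_nonneg (norm_nonneg _) (by linarith) hq.le]
            exact mul_le_mul_of_nonneg_right
              (Real.rpow_le_rpow (norm_nonneg _) (hpt i) (by linarith)) (by positivity)
        _ ≤ B ^ (p.toReal - q) * B ^ q := by
            rw [← Finset.mul_sum]
            exact mul_le_mul_of_nonneg_left (h T) (by positivity)
        _ = B ^ p.toReal := by
            rw [← Real.rpow_add_of_nonneg hB (by linarith) hq.le, ← e]
    exact ⟨⟨x, memℓp_gen' hsum⟩, rfl, lp.norm_le_of_forall_sum_le (by linarith) hB hsum⟩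

/-- `2α/(α-2)` is the inverse of `1/2 - 1/α`. The case `p = ⊤` is separate because its `toReal` is
`0`. -/
theorem sobolev_exponent_le {p : ℝ≥0∞} {α : ℝ} (hα : 2 < α)
    (hp : p⁻¹ ≤ ENNReal.ofReal (1 / 2 - 1 / α)) : p = ⊤ ∨ 2 * α / (α - 2) ≤ p.toReal := by
  refine or_iff_not_imp_left.2 fun htop => ?_
  have h0 : p ≠ 0 := by
    rintro rfl
    simp at hp
  have hpos : 0 < p.toReal := ENNReal.toReal_pos h0 htop
  have hnn : 0 < 1 / 2 - 1 / α := by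
    rw [sub_pos]
    exact one_div_lt_one_div_of_lt two_pos hα
  have h1 := ENNReal.toReal_mono ENNReal.ofReal_ne_top hp
  rw [ENNReal.toReal_inv, ENNReal.toReal_ofReal hnn.le] at h1
  have e : 2 * α / (α - 2) = (1 / 2 - 1 / α)⁻¹ := by
    have : α - 2 ≠ 0 := by linarith
    have : α ≠ 0 := by linarith
    field_simp
  rw [e]
  exact inv_le_of_inv_le₀ hpos h1

end Embedding

end SimplicialL2

/-! ### Closure of the range, and the main theorem. -/

open Filter Topology in
/-- If the coboundary controls the `ℓ^p` norm on `(ker d_k)ᗮ`, then every element of the closure of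
its `ℓ²` range has an `ℓ^p` primitive. -/
theorem SimplicialL2.exists_primitive_of_mem_closure {V W : Type*} [DecidableEq V] [LinearOrder W]
    [Finite W] {X : AbstractSimplicialComplex V} {K : AbstractSimplicialComplex W} {π : V → W}
    (hπ : IsCovering X K π) (k : ℕ) {p : ℝ≥0∞} [Fact (1 ≤ p)] {C' : ℝ} (hC' : 0 ≤ C')
    (h : ∀ β ∈ (LinearMap.ker (coboundaryL2 hπ k).toLinearMap)ᗮ,
      ∃ b : LpCochains X k p, ⇑b = ⇑β ∧ ‖b‖ ≤ C' * ‖coboundaryL2 hπ k β‖)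
    {ω : LpCochains X (k + 1) 2} (hω : ω ∈ closure (Set.range (coboundaryL2 hπ k))) :
    ∃ b : LpCochains X k p, coboundary π ⇑b = ⇑ω := by
  set D := coboundaryL2 hπ k with hD
  set N := LinearMap.ker D.toLinearMap with hN
  have : CompleteSpace N := (ContinuousLinearMap.isClosed_ker D).completeSpace_coe
  obtain ⟨y, hy, hlim⟩ := mem_closure_iff_seq_limit.1 hω
  choose z hz using hy
  -- Removing the kernel component keeps the image and makes the a priori estimate applicable, also
  -- to differences.
  have hx : ∀ n, ∃ x ∈ Nᗮ, D x = y n := fun n => by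
    refine ⟨z n - N.starProjection (z n), Submodule.sub_starProjection_mem_orthogonal _, ?_⟩
    have h0 : D (N.starProjection (z n)) = 0 := Submodule.starProjection_apply_mem N (z n)
    rw [map_sub, h0, sub_zero, hz]
  choose x hxN hxy using hx
  choose b hb _ using fun n => h (x n) (hxN n)
  have hdist : ∀ m n, dist (b m) (b n) ≤ C' * dist (y m) (y n) := fun m n => by
    obtain ⟨b', hb', hle⟩ := h (x m - x n) (Nᗮ.sub_mem (hxN m) (hxN n))
    have e : b' = b m - b n := lp.ext (by rw [hb', lp.coeFn_sub, lp.coeFn_sub, hb, hb])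
    rwa [e, map_sub, hxy, hxy, ← dist_eq_norm, ← dist_eq_norm] at hle
  have hcauchy : CauchySeq b := by
    rw [Metric.cauchySeq_iff]
    intro ε hε
    obtain ⟨n₀, hn₀⟩ := Metric.cauchySeq_iff.1 hlim.cauchySeq (ε / (C' + 1)) (by positivity)
    refine ⟨n₀, fun m hm n hn => (hdist m n).trans_lt ?_⟩
    have h1 := hn₀ m hm n hn
    rw [lt_div_iff₀ (by positivity)] at h1
    nlinarith [dist_nonneg (x := y m) (y := y n)]
  obtain ⟨b₀, hb₀⟩ := cauchySeq_tendsto_of_complete hcauchy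
  refine ⟨b₀, funext fun τ => ?_⟩
  -- At each `τ` the coboundary is a finite combination of evaluations, so continuity of evaluation
  -- on `ℓ^p` suffices.
  have h1 : Tendsto (fun n => coboundary π (⇑(b n)) τ) atTop (𝓝 (coboundary π (⇑b₀) τ)) :=
    tendsto_finsetSum _ fun v _ => Tendsto.const_mul _
      (((lp.evalCLM ℂ (fun _ : Simplices X k => ℂ) p
        (oppositeFace τ v v.2)).continuous.tendsto b₀).comp hb₀)
  have h2 : Tendsto (fun n => y n τ) atTop (𝓝 (ω τ)) :=
    ((lp.evalCLM ℂ (fun _ : Simplices X (k + 1) => ℂ) 2 τ).continuous.tendsto ω).comp hlim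
  refine tendsto_nhds_unique h1 (h2.congr fun n => ?_)
  rw [hb, ← hxy]
  rfl

theorem mainTheorem8 {Γ V W : Type*} [Group Γ] [MulAction Γ V] [DecidableEq V]
    [Finite W] [LinearOrder W]
    (X : AbstractSimplicialComplex V) (K : AbstractSimplicialComplex W) (π : V → W)
    (hπ : SimplicialL2.IsGaloisCovering Γ X K π) (k : ℕ) (C α : ℝ) (hα : 2 < α)
    (hF : ∀ lam : ℝ, 0 < lam →
      SimplicialL2.spectralDensity Γ hπ k lam ≤ ENNReal.ofReal (C * lam ^ (α / 2)))
    (p : ℝ≥0∞) (hp : p⁻¹ ≤ ENNReal.ofReal (1 / 2 - 1 / α)) :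
    (∃ C' : ℝ, ∀ β : SimplicialL2.LpCochains X k 2,
      β ∈ (LinearMap.ker (SimplicialL2.coboundaryL2 hπ.toIsCovering k).toLinearMap)ᗮ →
        ∃ b : SimplicialL2.LpCochains X k p, ⇑b = ⇑β ∧
          ‖b‖ ≤ C' * ‖SimplicialL2.coboundaryL2 hπ.toIsCovering k β‖) ∧
    (∀ ω ∈ closure (Set.range (SimplicialL2.coboundaryL2 hπ.toIsCovering k)),
      ∃ b : SimplicialL2.LpCochains X k p, SimplicialL2.coboundary π ⇑b = ⇑ω) := by
  have hpq := SimplicialL2.sobolev_exponent_le hα hp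
  have hq : 2 ≤ 2 * α / (α - 2) := by
    rw [le_div_iff₀ (by linarith)]
    linarith
  have hp1 : Fact (1 ≤ p) := ⟨by
    rcases hpq with rfl | h
    · exact le_top
    · rw [← ENNReal.ofReal_one]
      exact ENNReal.ofReal_le_of_le_toReal (by linarith)⟩
  -- `c = √C` arises from `√(C λ^(α/2)) = √C λ^(α/4)`.
  obtain ⟨M, hM, hsum⟩ := SimplicialL2.exists_sum_rpow_le (c := √C)
    (SimplicialL2.upLaplacian_nonneg hπ.toIsCovering k) hα (Real.sqrt_nonneg C)
    fun lam hl w hw σ => by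
      refine (SimplicialL2.norm_apply_le_of_spectralDensity_le hπ (hF lam hl) hw σ).trans_eq ?_
      rw [Real.sqrt_mul' _ (by positivity), Real.sqrt_eq_rpow (lam ^ (α / 2)),
        ← Real.rpow_mul hl.le]
      ring_nf
  have main : ∀ β : SimplicialL2.LpCochains X k 2,
      β ∈ (LinearMap.ker (SimplicialL2.coboundaryL2 hπ.toIsCovering k).toLinearMap)ᗮ →
        ∃ b : SimplicialL2.LpCochains X k p, ⇑b = ⇑β ∧
          ‖b‖ ≤ M * ‖SimplicialL2.coboundaryL2 hπ.toIsCovering k β‖ := fun β hβ => by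
    have h1 := hsum β (by
      rw [← ContinuousLinearMap.ker_adjoint_comp_self] at hβ
      exact hβ)
    have h2 := ContinuousLinearMap.apply_norm_sq_eq_inner_adjoint_right
      (SimplicialL2.coboundaryL2 hπ.toIsCovering k) β
    have h3 : √(⟪β, SimplicialL2.upLaplacian hπ.toIsCovering k β⟫_ℂ).re =
        ‖SimplicialL2.coboundaryL2 hπ.toIsCovering k β‖ :=
      (congrArg Real.sqrt h2.symm).trans (Real.sqrt_sq (norm_nonneg _))
    rw [h3] at h1
    exact SimplicialL2.exists_lp_norm_le (by linarith) (by positivity) h1 hpq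
  exact ⟨⟨M, main⟩, fun ω hω =>
    SimplicialL2.exists_primitive_of_mem_closure hπ.toIsCovering k hM main hω⟩
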